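/- All graphs are finite and simple. For a graph $G$, let $d(u)$ be the degree of a vertex $u$, let $\delta(G)$ be the minimum degree, and let $\xi(G)=\min\{d(u)+d(v)-2 : uv\in E(G)\}$ be the minimum edge-degree. The edge-connectivity $\lambda(G)$ is the minimum size of a set $S\subseteq E(G)$ such that $G-S$ is disconnected; $G$ is maximally edge-connected if $\lambda(G)=\delta(G)$. The 3-restricted edge-connectivity $\lambda_3(G)$ is the minimum size of a set $S\subseteq E(G)$ such that $G-S$ is disconnected and each component of $G-S$ has at least three vertices ($\lambda_3(G)=+\infty$ if there is no such $S$). Let $\xi_3(G)$ be the minimum, over all $X\subseteq V(G)$ with $|X|=3$ and $G[X]$ connected, of the number of edges of $G$ with exactly one end in $X$. A graph $G$ is maximally 3-restricted edge-connected if $\lambda_3(G)=\xi_3(G)$. The strong product $G\boxtimes H$ has vertex set $V(G)\times V(H)$, and $(x_1,y_1)$, $(x_2,y_2)$ are adjacent if and only if $x_1=x_2$ and $y_1y_2\in E(H)$, or $y_1=y_2$ and $x_1x_2\in E(G)$, or $x_1x_2\in E(G)$ and $y_1y_2\in E(H)$. Let $C_n$ be the cycle of order $n$. **Theorem 3.1.**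 Let $G$ be a maximally edge-connected graph of order $m\ge 5$ with $\delta(G)\ge 2$, and let $n\ge 4$. Then $$\lambda_3(G\boxtimes C_n)=\xi_3(G\boxtimes C_n)=\begin{cases}9\delta(G), & \text{if } \xi(G)=2\delta(G)-2;\\ 9\delta(G)+2, & \text{otherwise.}\end{cases}$$ That is, $G\boxtimes C_n$ is maximally 3-restricted edge-connected. -/

import Mathlib

namespace SimpleGraph

/-- The strong product `G ⊠ H` on the vertex set `V × W`. -/
def strongProd {V W : Type*} (G : SimpleGraph V) (H : SimpleGraph W) : SimpleGraph (V × W) where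
  Adj p q :=
    (p.1 = q.1 ∧ H.Adj p.2 q.2) ∨ (p.2 = q.2 ∧ G.Adj p.1 q.1) ∨ (G.Adj p.1 q.1 ∧ H.Adj p.2 q.2)
  symm := ⟨by
    rintro p q (⟨h, h'⟩ | ⟨h, h'⟩ | ⟨h, h'⟩)
    · exact Or.inl ⟨h.symm, h'.symm⟩
    · exact Or.inr (Or.inl ⟨h.symm, h'.symm⟩)
    · exact Or.inr (Or.inr ⟨h.symm, h'.symm⟩)⟩
  loopless := ⟨by
    rintro p (⟨_, h⟩ | ⟨_, h⟩ | ⟨h, _⟩)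
    · exact H.irrefl h
    · exact G.irrefl h
    · exact G.irrefl h⟩

/-- `S ⊆ E(G)` is an edge-cut if `G - S` is disconnected. -/
def IsEdgeCut {V : Type*} (G : SimpleGraph V) (S : Set (Sym2 V)) : Prop :=
  S ⊆ G.edgeSet ∧ ¬ (G.deleteEdges S).Preconnected

/-- The edge-connectivity `λ(G)`: the minimum size of an edge-cut (`⊤` if there is none). -/
noncomputable def edgeConnectivity {V : Type*} (G : SimpleGraph V) : ℕ∞ :=
  ⨅ (S : Set (Sym2 V)) (_ : G.IsEdgeCut S), S.encard

/-- `G` is maximally edge-connected if `λ(G) = δ(G)`. -/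
def IsMaximallyEdgeConnected {V : Type*} [Fintype V] (G : SimpleGraph V) [DecidableRel G.Adj] :
    Prop :=
  G.edgeConnectivity = (G.minDegree : ℕ∞)

/-- An edge-cut `S` is `k`-restricted if every component of `G - S` has at least `k` vertices. -/
def IsRestrictedEdgeCut {V : Type*} (G : SimpleGraph V) (k : ℕ) (S : Set (Sym2 V)) : Prop :=
  G.IsEdgeCut S ∧ ∀ c : (G.deleteEdges S).ConnectedComponent, (k : ℕ∞) ≤ c.supp.encard

/-- The `k`-restricted edge-connectivity `λ_k(G)`: the minimum size of a `k`-restricted edge-cut,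
and `⊤` if there is none. -/
noncomputable def restrictedEdgeConnectivity {V : Type*} (G : SimpleGraph V) (k : ℕ) : ℕ∞ :=
  ⨅ (S : Set (Sym2 V)) (_ : G.IsRestrictedEdgeCut k S), S.encard

/-- `∂_G(X)`: the set of edges with one end in `X` and the other outside `X`. -/
def edgeBoundary {V : Type*} (G : SimpleGraph V) (X : Set V) : Set (Sym2 V) :=
  {e | ∃ u v : V, u ∈ X ∧ v ∉ X ∧ G.Adj u v ∧ e = s(u, v)}

/-- `ξ₃(G)`: the minimum of `|∂_G(X)|` over the `3`-element vertex sets `X` with `G[X]`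
connected. -/
noncomputable def minThreeBoundary {V : Type*} (G : SimpleGraph V) : ℕ∞ :=
  ⨅ (X : Set V) (_ : X.encard = 3 ∧ (G.induce X).Connected), (G.edgeBoundary X).encard

/-- `G` is maximally `3`-restricted edge-connected if `λ₃(G) = ξ₃(G)`. -/
def IsMaximallyThreeRestrictedEdgeConnected {V : Type*} (G : SimpleGraph V) : Prop :=
  G.restrictedEdgeConnectivity 3 = G.minThreeBoundary

/-- The minimum edge-degree `ξ(G)`, the minimum of `d(u) + d(v) - 2` over all edges `uv`
(the subtraction never truncates, because both ends of an edge have positive degree). -/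
noncomputable def minEdgeDegree {V : Type*} [Fintype V] (G : SimpleGraph V)
    [DecidableRel G.Adj] : ℕ∞ :=
  ⨅ (u : V) (v : V) (_ : G.Adj u v), ((G.degree u + G.degree v - 2 : ℕ) : ℕ∞)

end SimpleGraph

/-!
The boundary of a vertex set `X` of `G ⊠ Cₙ` is counted layer by layer. Let `Xᵢ ⊆ V(G)` be the
trace of `X` on the `i`-th copy of `G`, let `d = δ(G) = λ(G)`, and count pairs by the closed
adjacency relation "equal or adjacent", which is multiplicative for the strong product. Then
`|∂X|` is the sum over `i` of the cut of `Xᵢ` in `G` and of the number `h(Xᵢ, Xᵢ₊₁)` of edges cut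
between consecutive layers (`closedPairs_strongProd_cycleGraph`). Three estimates carry the proof.

* A layer that is neither empty nor full contributes a cut of at least `λ(G) = d`.
* If two consecutive layers are both neither empty nor full, then `h ≥ 2d`
  (`two_mul_le_layerCross`): when the traces meet and do not cover `V(G)` this is submodularity,
  and otherwise the edges `(x, i)(x, i + 1)` help.
* The potential `w(P) = ∑_{u ∈ P} (d(u) + 1)` satisfies `|w(P) - w(Q)| ≤ h(P, Q)`. A cyclic
  sequence varies in total by at least twice the difference of any two of its values
  (`two_mul_sub_le_sum_of_cyclic`), so large layers are expensive next to an empty one.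

Together they give `|∂X| ≥ 9d + 2` whenever `X` and its complement have at least four vertices
(`nine_mul_add_two_le_cut`): if no layer is empty or full, the total is at least `3dn`; if there are
both an empty and a full layer, it is at least `2w(V)`; otherwise, after complementing, some layer
is empty and none is full, and `m` nonempty layers cost at least `3dm + 2`, which leaves only
`m ≤ 2`; there the sizes of the layers, at least four in total, decide.

For a triple, the boundary is three times the sum of the closed degrees `d(u) + 1` minus the closed
pairs inside, so it is at least `9d`, and at least `9d + 2` if no edge of `G` joins two vertices of
degree `d`, i.e. if `ξ(G) ≠ 2d - 2`. These values are attained by a triangle over such an edge and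
by a path inside one fibre `{u} × Cₙ`. Removing such a triple leaves whole fibres near every
remaining vertex, so its boundary is a `3`-restricted cut. Connectedness of the parts of a cut plays
no role in the lower bounds.
-/

namespace SimpleGraph

open Finset

/-! ### Closed adjacency counts and cuts between consecutive layers -/

section ClosedPairs

variable {V : Type*} (G : SimpleGraph V)

open Classical in
/-- The closed adjacency indicator: `1` if `u = v` or `u` and `v` are adjacent, and `0` otherwise.
Values are integers, so that counts can be subtracted freely. -/
noncomputable def closedAdj (u v : V) : ℤ := if u = v ∨ G.Adj u v then 1 else 0

/-- The number of pairs `(u, v) ∈ P × Q` with `u = v` or `u` adjacent to `v`. For disjoint `P` and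
`Q` it is the number of edges between `P` and `Q`. -/
noncomputable def closedPairs (P Q : Finset V) : ℤ := ∑ u ∈ P, ∑ v ∈ Q, G.closedAdj u v

theorem closedAdj_comm (u v : V) : G.closedAdj u v = G.closedAdj v u := by
  have h : (u = v ∨ G.Adj u v) ↔ (v = u ∨ G.Adj v u) := or_congr eq_comm (G.adj_comm u v)
  unfold closedAdj
  split_ifs <;> tauto

theorem closedAdj_nonneg (u v : V) : 0 ≤ G.closedAdj u v := by
  unfold closedAdj; split_ifs <;> norm_num

theorem closedAdj_le_one (u v : V) : G.closedAdj u v ≤ 1 := by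
  unfold closedAdj; split_ifs <;> norm_num

theorem closedAdj_self (u : V) : G.closedAdj u u = 1 := by simp [closedAdj]

variable {G} in
theorem Adj.closedAdj_eq_one {u v : V} (h : G.Adj u v) : G.closedAdj u v = 1 := by
  simp [closedAdj, h]

theorem closedPairs_comm (P Q : Finset V) : G.closedPairs P Q = G.closedPairs Q P := by
  unfold closedPairs
  rw [Finset.sum_comm]
  simp only [G.closedAdj_comm]

@[simp]
theorem closedPairs_empty_left (Q : Finset V) : G.closedPairs ∅ Q = 0 := by
  simp [closedPairs]

theorem closedPairs_nonneg (P Q : Finset V) : 0 ≤ G.closedPairs P Q :=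
  Finset.sum_nonneg fun _ _ => Finset.sum_nonneg fun _ _ => G.closedAdj_nonneg _ _

theorem closedPairs_le (P Q : Finset V) : G.closedPairs P Q ≤ #P * #Q := by
  unfold closedPairs
  calc ∑ u ∈ P, ∑ v ∈ Q, G.closedAdj u v ≤ ∑ u ∈ P, ∑ v ∈ Q, 1 :=
        Finset.sum_le_sum fun _ _ => Finset.sum_le_sum fun _ _ => G.closedAdj_le_one _ _
    _ = #P * #Q := by simp

theorem card_le_closedPairs_self (P : Finset V) : (#P : ℤ) ≤ G.closedPairs P P := by
  unfold closedPairs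
  calc (#P : ℤ) = ∑ u ∈ P, 1 := by simp
    _ ≤ _ := Finset.sum_le_sum fun u hu => by
      rw [← G.closedAdj_self u]
      exact Finset.single_le_sum (f := fun v => G.closedAdj u v)
        (fun _ _ => G.closedAdj_nonneg _ _) hu

theorem closedPairs_union_left [DecidableEq V] {P Q : Finset V} (h : Disjoint P Q)
    (R : Finset V) : G.closedPairs (P ∪ Q) R = G.closedPairs P R + G.closedPairs Q R := by
  unfold closedPairs
  rw [Finset.sum_union h]

theorem closedPairs_union_right [DecidableEq V] (R : Finset V) {P Q : Finset V}
    (h : Disjoint P Q) : G.closedPairs R (P ∪ Q) = G.closedPairs R P + G.closedPairs R Q := by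
  simp only [G.closedPairs_comm R, G.closedPairs_union_left h]

variable [Fintype V] [DecidableEq V]

theorem closedPairs_add_compl (P Q : Finset V) :
    G.closedPairs P Q + G.closedPairs P Qᶜ = G.closedPairs P univ := by
  rw [← G.closedPairs_union_right P disjoint_compl_right, Finset.union_compl]

theorem sum_closedAdj [DecidableRel G.Adj] (u : V) :
    ∑ v, G.closedAdj u v = G.degree u + 1 := by
  have h : ∀ v, G.closedAdj u v = (if u = v then 1 else 0) + if G.Adj u v then 1 else 0 := by
    intro v
    unfold closedAdj
    by_cases h1 : u = v
    · subst h1; simp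
    · simp [h1]
  simp only [h, Finset.sum_add_distrib, Finset.sum_ite_eq, Finset.mem_univ, if_true,
    Finset.sum_boole, ← card_neighborFinset_eq_degree, neighborFinset_eq_filter]
  ring

theorem closedPairs_univ [DecidableRel G.Adj] (P : Finset V) :
    G.closedPairs P univ = ∑ u ∈ P, ((G.degree u : ℤ) + 1) :=
  Finset.sum_congr rfl fun u _ => G.sum_closedAdj u

theorem card_mul_le_closedPairs_univ [DecidableRel G.Adj] {d : ℤ} (hd : ∀ u, d ≤ G.degree u)
    (P : Finset V) : #P * (d + 1) ≤ G.closedPairs P univ := by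
  rw [closedPairs_univ]
  calc #P * (d + 1) = ∑ u ∈ P, (d + 1) := by simp
    _ ≤ _ := Finset.sum_le_sum fun u _ => by linarith [hd u]

theorem card_mul_le_closedPairs_compl [DecidableRel G.Adj] {d : ℤ} (hd : ∀ u, d ≤ G.degree u)
    (P Q : Finset V) : #P * (d + 1) - #P * #Q ≤ G.closedPairs P Qᶜ := by
  linarith [G.closedPairs_add_compl P Q, G.closedPairs_le P Q,
    G.card_mul_le_closedPairs_univ hd P]

/-- The number of edges between two consecutive layers of `G ⊠ Cₙ` that leave a vertex set whose
traces on these layers are `P` and `Q`. -/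
noncomputable def layerCross (P Q : Finset V) : ℤ := G.closedPairs P Qᶜ + G.closedPairs Q Pᶜ

theorem layerCross_comm (P Q : Finset V) : G.layerCross P Q = G.layerCross Q P := add_comm _ _

theorem layerCross_compl (P Q : Finset V) : G.layerCross Pᶜ Qᶜ = G.layerCross P Q := by
  simp only [layerCross, compl_compl, G.closedPairs_comm Pᶜ, G.closedPairs_comm Qᶜ]
  ring

/-- The map `P ↦ closedPairs P univ` is a potential: it changes between two consecutive layers by
at most the number of edges cut between them. -/
theorem abs_closedPairs_univ_sub_le (P Q : Finset V) :
    |G.closedPairs P univ - G.closedPairs Q univ| ≤ G.layerCross P Q := by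
  have h1 := G.closedPairs_add_compl P Q
  have h2 := G.closedPairs_add_compl Q P
  have h3 := G.closedPairs_comm P Q
  have h4 := G.closedPairs_nonneg P Qᶜ
  have h5 := G.closedPairs_nonneg Q Pᶜ
  unfold layerCross
  rw [abs_le]
  constructor <;> linarith

theorem le_layerCross [DecidableRel G.Adj] {d : ℤ} (hd : ∀ u, d ≤ G.degree u) (P Q : Finset V) :
    (#P + #Q) * (d + 1) - 2 * #P * #Q ≤ G.layerCross P Q := by
  have h1 := G.card_mul_le_closedPairs_compl hd P Q
  have h2 := G.card_mul_le_closedPairs_compl hd Q P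
  unfold layerCross
  linarith

theorem closedPairs_eq_sum_ite (P Q : Finset V) :
    G.closedPairs P Q =
      ∑ u, ∑ v, if u ∈ P then (if v ∈ Q then G.closedAdj u v else 0) else 0 := by
  unfold closedPairs
  rw [← Finset.sum_filter_add_sum_filter_not univ (· ∈ P)]
  rw [Finset.sum_eq_zero (s := univ.filter fun u => ¬ u ∈ P)]
  · simp only [Finset.filter_univ_mem, add_zero]
    refine Finset.sum_congr rfl fun u hu => ?_
    simp [hu]
  · intro u hu
    simp [(Finset.mem_filter.1 hu).2]

/-- Submodularity of the cut function of `G`, with the two traces on different layers. -/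
theorem closedPairs_inter_add_union_le_layerCross (P Q : Finset V) :
    G.closedPairs (P ∩ Q) (P ∩ Q)ᶜ + G.closedPairs (P ∪ Q) (P ∪ Q)ᶜ ≤ G.layerCross P Q := by
  unfold layerCross
  simp only [closedPairs_eq_sum_ite, ← Finset.sum_add_distrib]
  refine Finset.sum_le_sum fun u _ => Finset.sum_le_sum fun v _ => ?_
  have := G.closedAdj_nonneg u v
  by_cases h1 : u ∈ P <;> by_cases h2 : u ∈ Q <;> by_cases h3 : v ∈ P <;> by_cases h4 : v ∈ Q <;>
    simp [h1, h2, h3, h4, this]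

/-- For disjoint traces the vertical edges contribute `#P + #Q` and the other cut edges include a
copy of the cut of `P ∪ Q`; this suffices if `d ≤ #P + #Q`. If `#P + #Q < d`, each vertex of `P` has
many neighbours outside `Q` and vice versa, and counting these suffices. -/
theorem le_layerCross_of_disjoint [DecidableRel G.Adj] {d : ℤ} (hd : ∀ u, d ≤ G.degree u)
    (hcut : ∀ P : Finset V, P.Nonempty → P ≠ univ → d ≤ G.closedPairs P Pᶜ)
    {P Q : Finset V} (hP : P.Nonempty) (hQ : Q.Nonempty) (hPQ : Disjoint P Q)
    (hU : P ∪ Q ≠ univ) : 2 * d ≤ G.layerCross P Q := by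
  have hp : (1 : ℤ) ≤ #P := by exact_mod_cast hP.card_pos
  have hq : (1 : ℤ) ≤ #Q := by exact_mod_cast hQ.card_pos
  by_cases hs : d ≤ #P + #Q
  · have hcompl : ∀ {A B : Finset V}, Disjoint A B →
        (#A : ℤ) + G.closedPairs A (A ∪ B)ᶜ ≤ G.closedPairs A Bᶜ := by
      intro A B hAB
      have h : Bᶜ = A ∪ (A ∪ B)ᶜ := by
        ext x
        have : x ∈ A → x ∉ B := fun h => Finset.disjoint_left.1 hAB h
        simp only [mem_compl, mem_union]
        tauto
      have hdis : Disjoint A (A ∪ B)ᶜ :=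
        disjoint_compl_right.mono_left Finset.subset_union_left
      rw [h, G.closedPairs_union_right A hdis]
      linarith [G.card_le_closedPairs_self A]
    have h1 := hcompl hPQ
    have h2 := hcompl hPQ.symm
    rw [Finset.union_comm Q P] at h2
    have h3 := hcut (P ∪ Q) (hP.mono Finset.subset_union_left) hU
    rw [G.closedPairs_union_left hPQ] at h3
    unfold layerCross
    linarith
  · have h1 := G.le_layerCross hd P Q
    nlinarith [mul_nonneg (sub_nonneg.2 hp) (sub_nonneg.2 (not_le.1 hs).le),
      mul_nonneg (sub_nonneg.2 hq) (sub_nonneg.2 (not_le.1 hs).le),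
      mul_nonneg (sub_nonneg.2 hp) (sub_nonneg.2 hp),
      mul_nonneg (sub_nonneg.2 hq) (sub_nonneg.2 hq),
      mul_nonneg (sub_nonneg.2 hp) (sub_nonneg.2 hq)]

/-- The case of complementary traces. If `#P < d`, each vertex of `Pᶜ` has more than `d - #P`
closed neighbours in `Pᶜ`; otherwise the vertical edges, one for each vertex of `G`, suffice. -/
theorem le_layerCross_self_compl [DecidableRel G.Adj] {d : ℤ} (hd : ∀ u, d ≤ G.degree u)
    (hV : 3 ≤ Fintype.card V) {P : Finset V} (hP : P.Nonempty) (hPc : #P ≤ #Pᶜ) :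
    2 * d ≤ G.layerCross P Pᶜ := by
  have h1 := G.card_le_closedPairs_self P
  have h2 := G.card_le_closedPairs_self Pᶜ
  have h3 := G.card_mul_le_closedPairs_compl hd Pᶜ P
  have hsum := Finset.card_add_card_compl P
  have hp : (1 : ℤ) ≤ #P := by exact_mod_cast hP.card_pos
  have hq : (2 : ℤ) ≤ #Pᶜ := by omega
  have hpq : (#P : ℤ) ≤ #Pᶜ := by exact_mod_cast hPc
  unfold layerCross
  rw [compl_compl]
  by_cases hs : d ≤ #P
  · linarith
  · nlinarith [mul_nonneg (sub_nonneg.2 hq) (sub_nonneg.2 (not_le.1 hs).le)]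

/-- Two consecutive layers that are both neither empty nor full have at least `2d` cut edges
between them. If the traces overlap without covering everything, this is submodularity of the cut
function; if they are disjoint or cover everything, the vertical edges count as well. -/
theorem two_mul_le_layerCross [DecidableRel G.Adj] {d : ℤ} (hd : ∀ u, d ≤ G.degree u)
    (hcut : ∀ P : Finset V, P.Nonempty → P ≠ univ → d ≤ G.closedPairs P Pᶜ)
    (hV : 3 ≤ Fintype.card V) {P Q : Finset V} (hP : P.Nonempty) (hP' : P ≠ univ)
    (hQ : Q.Nonempty) (hQ' : Q ≠ univ) : 2 * d ≤ G.layerCross P Q := by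
  have hPc : Pᶜ.Nonempty := by rwa [Finset.nonempty_iff_ne_empty, Ne, Finset.compl_eq_empty_iff]
  have hQc : Qᶜ.Nonempty := by rwa [Finset.nonempty_iff_ne_empty, Ne, Finset.compl_eq_empty_iff]
  by_cases hI : Disjoint P Q
  · by_cases hU : P ∪ Q = univ
    · have hQP : Q = Pᶜ :=
        (IsCompl.of_eq (Finset.disjoint_iff_inter_eq_empty.1 hI) hU).compl_eq.symm
      subst hQP
      rcases le_total #P #Pᶜ with h | h
      · exact G.le_layerCross_self_compl hd hV hP h
      · rw [layerCross_comm]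
        have := G.le_layerCross_self_compl hd hV hPc (by rwa [compl_compl])
        rwa [compl_compl] at this
    · exact G.le_layerCross_of_disjoint hd hcut hP hQ hI hU
  · have hI' : (P ∩ Q).Nonempty := Finset.not_disjoint_iff_nonempty_inter.1 hI
    by_cases hU : P ∪ Q = univ
    · rw [← layerCross_compl]
      refine G.le_layerCross_of_disjoint hd hcut hPc hQc ?_ ?_
      · rw [Finset.disjoint_iff_inter_eq_empty, ← Finset.compl_union, hU, Finset.compl_univ]
      · rw [← Finset.compl_inter]
        intro h
        rw [Finset.compl_eq_univ_iff] at h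
        exact hI'.ne_empty h
    · have h1 := hcut (P ∩ Q) hI' fun h => hP' (Finset.eq_univ_of_forall fun x =>
        (Finset.mem_inter.1 (h.symm ▸ Finset.mem_univ x : x ∈ P ∩ Q)).1)
      have h2 := hcut (P ∪ Q) (hP.mono Finset.subset_union_left) hU
      linarith [G.closedPairs_inter_add_union_le_layerCross P Q]

end ClosedPairs

/-! ### Variation along a cycle -/

open Fin.NatCast Fin.CommRing in
/-- A function on a cycle climbs from `b` to `a` along both arcs, so its total variation is at
least `2 * (w a - w b)`. -/
theorem two_mul_sub_le_sum_of_cyclic {k : ℕ} (w f : Fin (k + 1) → ℤ)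
    (h : ∀ i, |w i - w (i + 1)| ≤ f i) (a b : Fin (k + 1)) : 2 * (w a - w b) ≤ ∑ i, f i := by
  have hstep : ∀ p l : ℕ, |w (a + (p : Fin (k + 1))) - w (a + ((p + l : ℕ) : Fin (k + 1)))| ≤
      ∑ j ∈ Finset.Ico p (p + l), f (a + (j : Fin (k + 1))) := by
    intro p l
    induction l with
    | zero => simp
    | succ l ih =>
      rw [← add_assoc, Finset.sum_Ico_succ_top (by omega)]
      have h1 := h (a + ((p + l : ℕ) : Fin (k + 1)))
      have h2 : a + ((p + l : ℕ) : Fin (k + 1)) + 1 = a + ((p + l + 1 : ℕ) : Fin (k + 1)) := by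
        push_cast; ring
      rw [h2] at h1
      exact (abs_sub_le _ _ _).trans (add_le_add ih h1)
  have htot : ∑ i, f i = ∑ j ∈ Finset.Ico 0 (k + 1), f (a + (j : Fin (k + 1))) := by
    rw [← Finset.range_eq_Ico, Finset.sum_range, ← Equiv.sum_comp (Equiv.addLeft a)]
    simp
  obtain ⟨l, hl, hb⟩ : ∃ l : ℕ, l ≤ k + 1 ∧ b = a + (l : Fin (k + 1)) :=
    ⟨(b - a).val, (b - a).isLt.le, by simp⟩
  have h1 := hstep 0 l
  have h2 := hstep l (k + 1 - l)
  rw [Nat.add_sub_cancel' hl] at h2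
  rw [htot, ← Finset.sum_Ico_consecutive _ (Nat.zero_le l) hl]
  have h0 : ((k + 1 : ℕ) : Fin (k + 1)) = 0 := by simp
  rw [h0, add_zero, ← hb] at h2
  simp only [Nat.cast_zero, add_zero, zero_add, ← hb] at h1
  have h3 := (abs_le.1 h1).2
  have h4 := (abs_le.1 h2).1
  linarith

/-! ### Cuts of `G ⊠ Cₙ` in terms of layers -/

section Torus

variable {V : Type*} (G : SimpleGraph V)

theorem closedAdj_strongProd {W : Type*} (H : SimpleGraph W) (p q : V × W) :
    (G.strongProd H).closedAdj p q = G.closedAdj p.1 q.1 * H.closedAdj p.2 q.2 := by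
  obtain ⟨a, i⟩ := p
  obtain ⟨b, j⟩ := q
  simp only [closedAdj, strongProd, Prod.mk.injEq, mul_ite, mul_one, mul_zero]
  by_cases h1 : a = b <;> by_cases h2 : i = j <;> by_cases h3 : G.Adj a b <;>
    by_cases h4 : H.Adj i j <;> simp_all

theorem fin_add_one_ne {k : ℕ} (i : Fin (k + 4)) : i + 1 ≠ i := by
  simp

theorem fin_sub_one_ne {k : ℕ} (i : Fin (k + 4)) : i - 1 ≠ i := by
  simp

theorem fin_add_one_ne_sub_one {k : ℕ} (i : Fin (k + 4)) : i + 1 ≠ i - 1 := by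
  intro h
  rw [eq_sub_iff_add_eq, add_assoc, add_eq_left] at h
  have h2 : 2 % (k + 4) = 0 := by simpa [Fin.ext_iff, Fin.val_add] using h
  rw [Nat.mod_eq_of_lt (by omega)] at h2
  omega

/-- The closed neighbours of `i` in a cycle are `i`, `i + 1` and `i - 1`, and they are distinct
because the cycle has more than two vertices. -/
theorem sum_closedAdj_cycleGraph_mul {k : ℕ} (i : Fin (k + 4)) (F : Fin (k + 4) → ℤ) :
    ∑ j, (cycleGraph (k + 4)).closedAdj i j * F j = F i + F (i + 1) + F (i - 1) := by
  have h : ∀ j, (cycleGraph (k + 4)).closedAdj i j * F j =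
      (if i = j then F j else 0) + (if i + 1 = j then F j else 0) +
        (if i - 1 = j then F j else 0) := by
    intro j
    have h1 := fin_add_one_ne i
    have h2 := fin_sub_one_ne i
    have h3 := fin_add_one_ne_sub_one i
    have hadj : (cycleGraph (k + 4)).Adj i j ↔ i - 1 = j ∨ i + 1 = j := by
      rw [cycleGraph_adj]
      refine or_congr ⟨fun h => ?_, fun h => ?_⟩ ⟨fun h => ?_, fun h => ?_⟩
      · rw [← h]; abel
      · rw [← h]; abel
      · rw [← h]; abel
      · rw [← h]; abel
    simp only [closedAdj, hadj]
    by_cases e1 : i = j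
    · subst e1; simp [h1, h2]
    · by_cases e2 : i + 1 = j
      · subst e2; simp [h3.symm]
      · by_cases e3 : i - 1 = j <;> simp [e1, e2, e3]
  simp only [h, Finset.sum_add_distrib, Finset.sum_ite_eq, Finset.mem_univ, if_true]

variable [Fintype V] [DecidableEq V]

/-- The trace of `X ⊆ V × ι` on the copy of `V` at height `i`. -/
def layer {ι : Type*} [DecidableEq ι] (X : Finset (V × ι)) (i : ι) : Finset V :=
  univ.filter fun x => (x, i) ∈ X

theorem mem_layer {ι : Type*} [DecidableEq ι] {X : Finset (V × ι)} {i : ι} {x : V} :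
    x ∈ layer X i ↔ (x, i) ∈ X := by simp [layer]

theorem layer_compl {ι : Type*} [Fintype ι] [DecidableEq ι] (X : Finset (V × ι)) (i : ι) :
    layer Xᶜ i = (layer X i)ᶜ := by
  ext x
  simp [mem_layer]

theorem sum_eq_sum_layer {ι : Type*} [Fintype ι] [DecidableEq ι] (X : Finset (V × ι))
    (F : V × ι → ℤ) : ∑ p ∈ X, F p = ∑ i, ∑ x ∈ layer X i, F (x, i) := by
  simp only [layer, Finset.sum_filter]
  rw [Finset.sum_comm,
    ← Fintype.sum_prod_type' (f := fun x i => if (x, i) ∈ X then F (x, i) else 0)]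
  simp [Finset.sum_ite_mem]

theorem sum_card_layer {ι : Type*} [Fintype ι] [DecidableEq ι] (X : Finset (V × ι)) :
    ∑ i, (#(layer X i) : ℤ) = #X := by
  have := sum_eq_sum_layer X fun _ => 1
  simpa using this.symm

/-- The edge cut of `X` in `G ⊠ Cₙ` consists of the edges cut inside the layers and those cut
between consecutive layers. -/
theorem closedPairs_strongProd_cycleGraph {k : ℕ} (X : Finset (V × Fin (k + 4))) :
    (G.strongProd (cycleGraph (k + 4))).closedPairs X Xᶜ =
      ∑ i, G.closedPairs (layer X i) (layer X i)ᶜ +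
        ∑ i, G.layerCross (layer X i) (layer X (i + 1)) := by
  have h : (G.strongProd (cycleGraph (k + 4))).closedPairs X Xᶜ =
      ∑ i, ∑ j, (cycleGraph (k + 4)).closedAdj i j *
        G.closedPairs (layer X i) (layer X j)ᶜ := by
    unfold closedPairs
    rw [sum_eq_sum_layer]
    refine Finset.sum_congr rfl fun i _ => ?_
    simp only [sum_eq_sum_layer Xᶜ, layer_compl, closedAdj_strongProd, Finset.mul_sum]
    rw [Finset.sum_comm]
    refine Finset.sum_congr rfl fun j _ => Finset.sum_congr rfl fun x _ =>
      Finset.sum_congr rfl fun y _ => mul_comm _ _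
  rw [h]
  simp only [sum_closedAdj_cycleGraph_mul, layerCross, Finset.sum_add_distrib]
  rw [add_assoc]
  congr 2
  rw [← Equiv.sum_comp (Equiv.addRight (1 : Fin (k + 4)))]
  simp

theorem card_mul_le_closedPairs_self_compl [DecidableRel G.Adj] {d : ℤ}
    (hd : ∀ u, d ≤ G.degree u) (P : Finset V) :
    #P * (d + 1) - #P * #P ≤ G.closedPairs P Pᶜ :=
  G.card_mul_le_closedPairs_compl hd P P

/-- If some layer of `X` is empty and none is full, then the cut between consecutive layers is at
least `2d` for each of the nonempty layers plus twice an extra term `c`, which comes from the two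
ends of a run of nonempty layers. -/
theorem le_sum_layerCross {k : ℕ} {d c : ℤ} {A : Fin (k + 4) → Finset V}
    (hmix : ∀ i j, (A i).Nonempty → (A j).Nonempty → 2 * d ≤ G.layerCross (A i) (A j))
    (hw : ∀ i, (A i).Nonempty → d + c ≤ G.closedPairs (A i) univ) (hc : 0 ≤ c)
    (h1 : ∃ i, (A i).Nonempty) (h0 : ∃ i, A i = ∅) :
    2 * d * #{i | (A i).Nonempty} + 2 * c ≤ ∑ i, G.layerCross (A i) (A (i + 1)) := by
  classical
  let χ : Fin (k + 4) → ℤ := fun i => if (A i).Nonempty then 1 else 0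
  obtain ⟨a, ha⟩ := h1
  obtain ⟨b, hb⟩ := h0
  have hsum : ∑ i, χ i = #{i | (A i).Nonempty} := by simp [χ]
  have hsum' : ∑ i, χ (i + 1) = ∑ i, χ i :=
    Equiv.sum_comp (Equiv.addRight (1 : Fin (k + 4))) χ
  have hvar := two_mul_sub_le_sum_of_cyclic χ
    (fun i => |χ i - χ (i + 1)|) (fun i => le_rfl) a b
  have hχ : χ a = 1 ∧ χ b = 0 := by simp [χ, ha, hb]
  have hstep : ∀ i, d * χ i + d * χ (i + 1) + c * |χ i - χ (i + 1)| ≤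
      G.layerCross (A i) (A (i + 1)) := by
    intro i
    have habs := G.abs_closedPairs_univ_sub_le (A i) (A (i + 1))
    by_cases e1 : (A i).Nonempty <;> by_cases e2 : (A (i + 1)).Nonempty
    · have := hmix _ _ e1 e2
      simp only [χ, e1, e2, if_true, sub_self, abs_zero]
      linarith
    · have := hw _ e1
      rw [Finset.not_nonempty_iff_eq_empty] at e2
      have h := (abs_le.1 habs).2
      simp only [e2, closedPairs_empty_left] at h
      simp [χ, e1, e2]
      linarith
    · have := hw _ e2
      rw [Finset.not_nonempty_iff_eq_empty] at e1
      have h := (abs_le.1 habs).1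
      simp only [e1, closedPairs_empty_left] at h
      simp [χ, e1, e2]
      linarith
    · rw [Finset.not_nonempty_iff_eq_empty] at e1 e2
      simp [χ, e1, e2, layerCross, closedPairs]
  have := Finset.sum_le_sum fun i (_ : i ∈ univ) => hstep i
  simp only [Finset.sum_add_distrib, ← Finset.mul_sum, hsum', hsum] at this
  rw [hχ.1, hχ.2] at hvar
  nlinarith [mul_le_mul_of_nonneg_left hvar hc]

end Torus

/-! ### Sets with at least four vertices inside and outside -/

section LowerBound

variable {V : Type*} (G : SimpleGraph V) [Fintype V] [DecidableEq V] [DecidableRel G.Adj]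

/-- The lower bound on the cut when some layer is empty and none is full. Three or more nonempty
layers suffice by their number; otherwise their sizes, at least four in total, do. -/
theorem le_cut_of_exists_layer_eq_empty {k : ℕ} {d : ℤ} (hd : ∀ u, d ≤ G.degree u)
    (hcut : ∀ P : Finset V, P.Nonempty → P ≠ univ → d ≤ G.closedPairs P Pᶜ)
    (hd2 : 2 ≤ d) (hV : 3 ≤ Fintype.card V) {A : Fin (k + 4) → Finset V}
    (hne : ∀ i, A i ≠ univ) (h0 : ∃ i, A i = ∅) (hcard : 4 ≤ ∑ i, #(A i)) :
    9 * d + 2 ≤ ∑ i, G.closedPairs (A i) (A i)ᶜ + ∑ i, G.layerCross (A i) (A (i + 1)) := by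
  classical
  set K : Finset (Fin (k + 4)) := {i | (A i).Nonempty} with hK
  have hmemK : ∀ {i}, i ∈ K ↔ (A i).Nonempty := by simp [hK]
  have hsumK : ∑ i ∈ K, #(A i) = ∑ i, #(A i) := by
    refine Finset.sum_subset (Finset.subset_univ K) fun i _ hi => ?_
    rw [hmemK, Finset.not_nonempty_iff_eq_empty] at hi
    simp [hi]
  have hKpos : 0 < #K := by
    rw [Finset.card_pos, Finset.nonempty_iff_ne_empty]
    intro h
    rw [h, Finset.sum_empty] at hsumK
    omega
  obtain ⟨a0, ha0⟩ := Finset.card_pos.1 hKpos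
  have hLK : ∑ i ∈ K, G.closedPairs (A i) (A i)ᶜ ≤ ∑ i, G.closedPairs (A i) (A i)ᶜ :=
    Finset.sum_le_sum_of_subset_of_nonneg (Finset.subset_univ K) fun i _ _ =>
      G.closedPairs_nonneg _ _
  have hcutK : ∀ i ∈ K, d ≤ G.closedPairs (A i) (A i)ᶜ := fun i hi =>
    hcut _ (hmemK.1 hi) (hne i)
  have hL : d * #K ≤ ∑ i, G.closedPairs (A i) (A i)ᶜ := by
    refine le_trans ?_ hLK
    calc d * #K = ∑ i ∈ K, d := by simp [mul_comm]
      _ ≤ _ := Finset.sum_le_sum hcutK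
  have hmix : ∀ i j, (A i).Nonempty → (A j).Nonempty → 2 * d ≤ G.layerCross (A i) (A j) :=
    fun i j hi hj => G.two_mul_le_layerCross hd hcut hV hi (hne i) hj (hne j)
  have hw := fun i => G.card_mul_le_closedPairs_univ hd (A i)
  have hpeak : ∀ i, 2 * (#(A i) * (d + 1)) ≤ ∑ i, G.layerCross (A i) (A (i + 1)) := by
    intro i
    obtain ⟨b, hb⟩ := h0
    have := two_mul_sub_le_sum_of_cyclic (fun i => G.closedPairs (A i) univ) _
      (fun i => G.abs_closedPairs_univ_sub_le (A i) (A (i + 1))) i b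
    simp only [hb, closedPairs_empty_left] at this
    linarith [hw i]
  have hS1 := G.le_sum_layerCross (c := 1) hmix
    (fun i hi => by
      have : (1 : ℤ) ≤ #(A i) := by exact_mod_cast hi.card_pos
      nlinarith [hw i]) zero_le_one ⟨a0, hmemK.1 ha0⟩ h0
  rw [← hK] at hS1
  -- A layer with four vertices costs `8 * (d + 1)` in potential, and its own cut gives `d` more.
  by_cases h4 : ∃ i, 4 ≤ #(A i)
  · obtain ⟨i, hi⟩ := h4
    have h1 : (4 : ℤ) ≤ #(A i) := by exact_mod_cast hi
    have h2 : (1 : ℤ) ≤ #K := by exact_mod_cast hKpos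
    nlinarith [hpeak i]
  push Not at h4
  by_cases h3 : 3 ≤ #K
  · have h3 : (3 : ℤ) ≤ #K := by exact_mod_cast h3
    nlinarith
  have hK1 : #K ≠ 1 := by
    intro h
    obtain ⟨a, ha⟩ := Finset.card_eq_one.1 h
    rw [ha, Finset.sum_singleton] at hsumK
    have := h4 a
    omega
  obtain ⟨a, b, hab, hKab⟩ := Finset.card_eq_two.1 (show #K = 2 by omega)
  rw [hKab, Finset.sum_pair hab] at hsumK hLK
  have hself := fun i => G.card_mul_le_closedPairs_self_compl hd (A i)
  have hca := hcutK a (by simp [hKab])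
  have hcb := hcutK b (by simp [hKab])
  have hthree : ∀ i, #(A i) = 3 →
      3 * d - 6 ≤ G.closedPairs (A i) (A i)ᶜ ∧
        6 * (d + 1) ≤ ∑ i, G.layerCross (A i) (A (i + 1)) := by
    intro i hi
    have h1 := hself i
    have h2 := hpeak i
    rw [hi] at h1 h2
    push_cast at h1 h2
    constructor <;> linarith
  by_cases ha3 : #(A a) = 3
  · have := hthree a ha3
    linarith
  by_cases hb3 : #(A b) = 3
  · have := hthree b hb3
    linarith
  have h4a := h4 a
  have h4b := h4 b
  have ha2 : #(A a) = 2 := by omega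
  have hb2 : #(A b) = 2 := by omega
  -- Two layers of size two: each end of a run cuts at least `2 * (d + 1) = d + (d + 2)` edges.
  have hS2 := G.le_sum_layerCross (c := d + 2) hmix
    (fun i hi => by
      have h := hw i
      rw [← hmemK, hKab, Finset.mem_insert, Finset.mem_singleton] at hi
      rcases hi with rfl | rfl
      · rw [ha2] at h; push_cast at h; linarith
      · rw [hb2] at h; push_cast at h; linarith) (by linarith) ⟨a0, hmemK.1 ha0⟩ h0
  rw [← hK, hKab, Finset.card_pair hab] at hS2
  have h1 := hself a
  have h2 := hself b
  rw [ha2] at h1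
  rw [hb2] at h2
  push_cast at h1 h2 hS2
  linarith

/-- Every vertex set of `G ⊠ Cₙ` with at least four vertices inside and outside has a cut of
size at least `9d + 2`. -/
theorem nine_mul_add_two_le_cut {k : ℕ} {d : ℤ} (hd : ∀ u, d ≤ G.degree u)
    (hcut : ∀ P : Finset V, P.Nonempty → P ≠ univ → d ≤ G.closedPairs P Pᶜ)
    (hd2 : 2 ≤ d) (hV : 5 ≤ Fintype.card V) (X : Finset (V × Fin (k + 4)))
    (hX : 4 ≤ #X) (hXc : 4 ≤ #Xᶜ) :
    9 * d + 2 ≤ (G.strongProd (cycleGraph (k + 4))).closedPairs X Xᶜ := by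
  have hXsum : ∀ Y : Finset (V × Fin (k + 4)), 4 ≤ #Y → 4 ≤ ∑ i, #(layer Y i) := by
    intro Y hY
    have := sum_card_layer Y
    zify
    rw [this]
    exact_mod_cast hY
  by_cases h0 : ∃ i, layer X i = ∅
  · by_cases h1 : ∃ i, layer X i = univ
    · -- The potential climbs from an empty layer to a full one along both arcs of the cycle.
      obtain ⟨b, hb⟩ := h0
      obtain ⟨a, ha⟩ := h1
      have h := two_mul_sub_le_sum_of_cyclic (fun i => G.closedPairs (layer X i) univ) _
        (fun i => G.abs_closedPairs_univ_sub_le (layer X i) (layer X (i + 1))) a b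
      have hw := G.card_mul_le_closedPairs_univ hd univ
      have hL : 0 ≤ ∑ i, G.closedPairs (layer X i) (layer X i)ᶜ :=
        Finset.sum_nonneg fun i _ => G.closedPairs_nonneg _ _
      simp only [hb, ha, closedPairs_empty_left] at h
      rw [Finset.card_univ] at hw
      have hV' : (5 : ℤ) ≤ Fintype.card V := by exact_mod_cast hV
      rw [closedPairs_strongProd_cycleGraph]
      nlinarith
    · push Not at h1
      rw [closedPairs_strongProd_cycleGraph]
      exact G.le_cut_of_exists_layer_eq_empty hd hcut hd2 (by omega) h1 h0 (hXsum X hX)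
  · push Not at h0
    by_cases h1 : ∃ i, layer X i = univ
    · -- Passing to the complement exchanges full and empty layers.
      rw [closedPairs_comm]
      conv_rhs => rw [← compl_compl X, compl_compl Xᶜ]
      rw [closedPairs_strongProd_cycleGraph]
      refine G.le_cut_of_exists_layer_eq_empty hd hcut hd2 (by omega) (fun i => ?_) ?_
        (hXsum Xᶜ hXc)
      · rw [layer_compl, Ne, Finset.compl_eq_univ_iff]
        exact (h0 i).ne_empty
      · obtain ⟨i, hi⟩ := h1
        exact ⟨i, by rw [layer_compl, hi, Finset.compl_univ]⟩
    · push Not at h1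
      rw [closedPairs_strongProd_cycleGraph, ← Finset.sum_add_distrib]
      have hstep : ∀ i, 3 * d ≤ G.closedPairs (layer X i) (layer X i)ᶜ +
          G.layerCross (layer X i) (layer X (i + 1)) := by
        intro i
        have h2 := hcut _ (h0 i) (h1 i)
        have h3 := G.two_mul_le_layerCross hd hcut (by omega) (h0 i) (h1 i)
          (h0 (i + 1)) (h1 (i + 1))
        linarith
      have h := Finset.sum_le_sum fun i (_ : i ∈ univ) => hstep i
      simp only [Finset.sum_const, Finset.card_univ, Fintype.card_fin, nsmul_eq_mul] at h
      push_cast at h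
      have hk : (0 : ℤ) ≤ k := by positivity
      nlinarith

end LowerBound

/-! ### Edge boundaries and restricted edge cuts -/

section EdgeCuts

variable {V : Type*} (G : SimpleGraph V)

theorem mem_iff_mem_of_reachable_deleteEdges_edgeBoundary {X : Set V} {u v : V}
    (h : (G.deleteEdges (G.edgeBoundary X)).Reachable u v) : u ∈ X ↔ v ∈ X := by
  obtain ⟨p⟩ := h
  induction p with
  | nil => rfl
  | @cons u v w hadj _ ih =>
    refine Iff.trans ?_ ih
    rw [deleteEdges_adj] at hadj
    obtain ⟨hadj, hnot⟩ := hadj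
    constructor
    · intro hu
      by_contra hv
      exact hnot ⟨u, v, hu, hv, hadj, rfl⟩
    · intro hv
      by_contra hu
      exact hnot ⟨v, u, hv, hu, hadj.symm, Sym2.eq_swap⟩

theorem deleteEdges_edgeBoundary_adj {X : Set V} {u v : V} (h : G.Adj u v)
    (huv : u ∈ X ↔ v ∈ X) : (G.deleteEdges (G.edgeBoundary X)).Adj u v := by
  rw [deleteEdges_adj]
  refine ⟨h, ?_⟩
  rintro ⟨a, b, ha, hb, -, he⟩
  rcases Sym2.eq_iff.1 he with ⟨rfl, rfl⟩ | ⟨rfl, rfl⟩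
  · exact hb (huv.1 ha)
  · exact hb (huv.2 ha)

theorem isEdgeCut_edgeBoundary {X : Set V} {u v : V} (hu : u ∈ X) (hv : v ∉ X) :
    G.IsEdgeCut (G.edgeBoundary X) := by
  refine ⟨?_, fun h => hv ?_⟩
  · rintro e ⟨a, b, -, -, hab, rfl⟩
    exact hab
  · exact (G.mem_iff_mem_of_reachable_deleteEdges_edgeBoundary (h u v)).1 hu

variable [Fintype V] [DecidableEq V]

theorem encard_edgeBoundary (X : Finset V) :
    ∃ N : ℕ, (G.edgeBoundary (X : Set V)).encard = N ∧ (N : ℤ) = G.closedPairs X Xᶜ := by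
  classical
  set F : Finset (V × V) := (X ×ˢ Xᶜ).filter fun p => G.Adj p.1 p.2 with hF
  have himg : G.edgeBoundary (X : Set V) = (fun p : V × V => s(p.1, p.2)) '' (F : Set (V × V)) := by
    ext e
    simp only [edgeBoundary, Set.mem_ofPred_eq, Set.mem_image, hF, Finset.mem_coe,
      Finset.mem_filter, Finset.mem_product, Finset.mem_compl, Prod.exists]
    constructor
    · rintro ⟨u, v, hu, hv, h, rfl⟩
      exact ⟨u, v, ⟨⟨hu, hv⟩, h⟩, rfl⟩
    · rintro ⟨u, v, ⟨⟨hu, hv⟩, h⟩, rfl⟩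
      exact ⟨u, v, hu, hv, h, rfl⟩
  have hinj : Set.InjOn (fun p : V × V => s(p.1, p.2)) (F : Set (V × V)) := by
    rintro ⟨a, b⟩ h1 ⟨c, d⟩ h2 he
    simp only [hF, Finset.mem_coe, Finset.mem_filter, Finset.mem_product,
      Finset.mem_compl] at h1 h2
    rcases Sym2.eq_iff.1 he with ⟨rfl, rfl⟩ | ⟨rfl, rfl⟩
    · rfl
    · exact absurd h1.1.1 h2.1.2
  refine ⟨#F, ?_, ?_⟩
  · rw [himg, hinj.encard_image, Set.encard_coe_eq_coe_finsetCard]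
  · rw [hF, closedPairs, ← Finset.sum_product', Finset.card_filter]
    push_cast
    refine Finset.sum_congr rfl fun p hp => ?_
    rw [Finset.mem_product, Finset.mem_compl] at hp
    have hne : p.1 ≠ p.2 := fun h => hp.2 (h ▸ hp.1)
    simp [closedAdj, hne]

theorem IsMaximallyEdgeConnected.minDegree_le_closedPairs_compl {G : SimpleGraph V}
    [DecidableRel G.Adj] (hG : G.IsMaximallyEdgeConnected) {P : Finset V} (hP : P.Nonempty)
    (hP' : P ≠ univ) : (G.minDegree : ℤ) ≤ G.closedPairs P Pᶜ := by
  obtain ⟨u, hu⟩ := hP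
  obtain ⟨v, hv⟩ : ∃ v, v ∉ P := by
    by_contra! h
    exact hP' (Finset.eq_univ_of_forall h)
  obtain ⟨N, hN, hN'⟩ := G.encard_edgeBoundary P
  have h : G.edgeConnectivity ≤ (G.edgeBoundary (P : Set V)).encard :=
    iInf₂_le _ (G.isEdgeCut_edgeBoundary (X := (P : Set V)) hu hv)
  rw [hG, hN] at h
  rw [← hN']
  exact_mod_cast h

/-- A `k`-restricted edge cut contains the boundary of one of its components, and this component
and its complement both have at least `k` vertices. -/
theorem IsRestrictedEdgeCut.exists_edgeBoundary_subset {G : SimpleGraph V} {k : ℕ}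
    {S : Set (Sym2 V)} (hS : G.IsRestrictedEdgeCut k S) :
    ∃ X : Finset V, k ≤ #X ∧ k ≤ #Xᶜ ∧ G.edgeBoundary (X : Set V) ⊆ S := by
  classical
  obtain ⟨⟨-, hdis⟩, hcomp⟩ := hS
  unfold Preconnected at hdis
  push Not at hdis
  obtain ⟨u, v, huv⟩ := hdis
  set c := (G.deleteEdges S).connectedComponentMk u
  set c' := (G.deleteEdges S).connectedComponentMk v
  have hcc : c ≠ c' := fun h => huv (ConnectedComponent.eq.1 h)
  refine ⟨c.supp.toFinset, ?_, ?_, ?_⟩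
  · have := hcomp c
    rw [Set.encard_eq_coe_toFinset_card] at this
    exact_mod_cast this
  · have h := hcomp c'
    rw [Set.encard_eq_coe_toFinset_card] at h
    refine le_trans (by exact_mod_cast h) (Finset.card_le_card fun x hx => ?_)
    rw [Set.mem_toFinset, ConnectedComponent.mem_supp_iff] at hx
    rw [Finset.mem_compl, Set.mem_toFinset, ConnectedComponent.mem_supp_iff, hx]
    exact hcc.symm
  · rintro e ⟨a, b, ha, hb, hab, rfl⟩
    by_contra hS
    rw [Set.coe_toFinset, ConnectedComponent.mem_supp_iff] at ha hb
    refine hb (ha ▸ ?_)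
    have hadj : (G.deleteEdges S).Adj b a := by
      rw [deleteEdges_adj, Sym2.eq_swap]
      exact ⟨hab.symm, hS⟩
    exact ConnectedComponent.eq.2 hadj.reachable

end EdgeCuts

/-! ### Boundaries of triples -/

section ThreeSets

variable {V : Type*} (G : SimpleGraph V)

theorem induce_connected_of_adj_adj {a b c : V} {X : Set V} (hX : X = {c, a, b})
    (ha : G.Adj c a) (hb : G.Adj c b) : (G.induce X).Connected := by
  subst hX
  rw [connected_iff_exists_forall_reachable]
  refine ⟨⟨c, by simp⟩, ?_⟩
  rintro ⟨w, rfl | rfl | rfl⟩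
  · exact Reachable.refl _
  · exact Adj.reachable ha
  · exact Adj.reachable hb

variable [Fintype V] [DecidableEq V] [DecidableRel G.Adj]

theorem closedPairs_strongProd_cycleGraph_univ {k : ℕ} (X : Finset (V × Fin (k + 4))) :
    (G.strongProd (cycleGraph (k + 4))).closedPairs X univ =
      ∑ p ∈ X, 3 * ((G.degree p.1 : ℤ) + 1) := by
  refine Finset.sum_congr rfl fun p _ => ?_
  simp only [closedAdj_strongProd, Fintype.sum_prod_type, ← Finset.mul_sum]
  have h := sum_closedAdj_cycleGraph_mul p.2 fun _ => 1
  simp only [mul_one] at h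
  rw [h, ← Finset.sum_mul, sum_closedAdj]
  ring

theorem nine_mul_le_cut_of_card_eq_three {k : ℕ} {d : ℤ} (hd : ∀ u, d ≤ G.degree u)
    {X : Finset (V × Fin (k + 4))} (hX : #X = 3) :
    9 * d ≤ (G.strongProd (cycleGraph (k + 4))).closedPairs X Xᶜ := by
  have h1 := (G.strongProd (cycleGraph (k + 4))).closedPairs_add_compl X X
  have h2 := (G.strongProd (cycleGraph (k + 4))).closedPairs_le X X
  rw [closedPairs_strongProd_cycleGraph_univ] at h1
  have h3 : ∑ p ∈ X, 3 * (d + 1) ≤ ∑ p ∈ X, 3 * ((G.degree p.1 : ℤ) + 1) :=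
    Finset.sum_le_sum fun p _ => by linarith [hd p.1]
  rw [Finset.sum_const, hX, nsmul_eq_mul] at h3
  rw [hX] at h2
  push_cast at h2 h3
  linarith

/-- A cycle with at least four vertices has no triangle. -/
theorem cycleGraph_exists_eq_of_closedAdj {k : ℕ} {i j l : Fin (k + 4)}
    (hij : i = j ∨ (cycleGraph (k + 4)).Adj i j) (hjl : j = l ∨ (cycleGraph (k + 4)).Adj j l)
    (hil : i = l ∨ (cycleGraph (k + 4)).Adj i l) : i = j ∨ j = l ∨ i = l := by
  by_contra! h
  obtain ⟨h1, h2, h3⟩ := h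
  have a1 := hij.resolve_left h1
  have a2 := hjl.resolve_left h2
  have a3 := hil.resolve_left h3
  rw [cycleGraph_adj'] at a1 a2 a3
  rw [Ne, Fin.ext_iff] at h1 h2 h3
  simp only [Fin.sub_def] at a1 a2 a3
  have hi := i.isLt
  have hj := j.isLt
  have hl := l.isLt
  have hmod : ∀ x, x < 2 * (k + 4) → x % (k + 4) = 1 → x = 1 ∨ x = k + 5 := by
    intro x hx h
    rcases lt_or_ge x (k + 4) with hlt | hge
    · rw [Nat.mod_eq_of_lt hlt] at h
      exact Or.inl h
    · rw [Nat.mod_eq_sub_mod hge, Nat.mod_eq_of_lt (by omega)] at h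
      omega
  have b1 := a1.imp (hmod _ (by omega)) (hmod _ (by omega))
  have b2 := a2.imp (hmod _ (by omega)) (hmod _ (by omega))
  have b3 := a3.imp (hmod _ (by omega)) (hmod _ (by omega))
  omega

/-- The boundary of a triple, in terms of the degrees in `G` and of the adjacent pairs inside. -/
theorem cut_triple {k : ℕ} {p q r : V × Fin (k + 4)} (hpq : p ≠ q) (hpr : p ≠ r) (hqr : q ≠ r) :
    (G.strongProd (cycleGraph (k + 4))).closedPairs {p, q, r} {p, q, r}ᶜ =
      3 * (G.degree p.1 + G.degree q.1 + G.degree r.1) + 6 -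
        2 * ((G.strongProd (cycleGraph (k + 4))).closedAdj p q +
          (G.strongProd (cycleGraph (k + 4))).closedAdj q r +
          (G.strongProd (cycleGraph (k + 4))).closedAdj p r) := by
  set H := G.strongProd (cycleGraph (k + 4)) with hH
  have h1 := H.closedPairs_add_compl {p, q, r} {p, q, r}
  have hsum : ∀ F : V × Fin (k + 4) → ℤ, ∑ x ∈ ({p, q, r} : Finset _), F x = F p + F q + F r := by
    intro F
    rw [Finset.sum_insert (by simp [hpq, hpr]), Finset.sum_pair hqr, add_assoc]
  rw [hH, closedPairs_strongProd_cycleGraph_univ, ← hH, hsum] at h1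
  have hself : H.closedPairs {p, q, r} {p, q, r} =
      3 + 2 * (H.closedAdj p q + H.closedAdj q r + H.closedAdj p r) := by
    simp only [closedPairs, hsum, closedAdj_self, H.closedAdj_comm q p, H.closedAdj_comm r p,
      H.closedAdj_comm r q]
    ring
  linarith

/-- If no edge of `G` joins two vertices of degree `d`, the bound for triples improves by `2`: a
triangle of `G ⊠ Cₙ` has two vertices in the same layer, as `Cₙ` has no triangle, and their first
coordinates form an edge of `G`. -/
theorem nine_mul_add_two_le_cut_of_card_eq_three {k : ℕ} {d : ℤ} (hd : ∀ u, d ≤ G.degree u)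
    (hedge : ∀ u v, G.Adj u v → 2 * d + 1 ≤ G.degree u + G.degree v)
    {X : Finset (V × Fin (k + 4))} (hX : #X = 3) :
    9 * d + 2 ≤ (G.strongProd (cycleGraph (k + 4))).closedPairs X Xᶜ := by
  set H := G.strongProd (cycleGraph (k + 4)) with hH
  obtain ⟨p, q, r, hpq, hpr, hqr, rfl⟩ := Finset.card_eq_three.1 hX
  rw [hH, G.cut_triple hpq hpr hqr, ← hH]
  have hdp := hd p.1
  have hdq := hd q.1
  have hdr := hd r.1
  have b1 := H.closedAdj_le_one p q
  have b2 := H.closedAdj_le_one q r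
  have b3 := H.closedAdj_le_one p r
  by_cases hall : H.Adj p q ∧ H.Adj q r ∧ H.Adj p r
  · obtain ⟨e1, e2, e3⟩ := hall
    have hcyc : ∀ {x y : V × Fin (k + 4)}, H.Adj x y →
        x.2 = y.2 ∨ (cycleGraph (k + 4)).Adj x.2 y.2 := by
      rintro x y (h | h | h)
      · exact Or.inr h.2
      · exact Or.inl h.1
      · exact Or.inr h.2
    have hsame : ∀ {x y : V × Fin (k + 4)}, H.Adj x y → x.2 = y.2 →
        2 * d + 1 ≤ G.degree x.1 + G.degree y.1 := by
      rintro x y (h | h | h) hxy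
      · exact absurd hxy h.2.ne
      · exact hedge _ _ h.2
      · exact absurd hxy h.2.ne
    rcases cycleGraph_exists_eq_of_closedAdj (hcyc e1) (hcyc e2) (hcyc e3) with h | h | h
    · linarith [hsame e1 h]
    · linarith [hsame e2 h]
    · linarith [hsame e3 h]
  · have hzero : ∀ {x y : V × Fin (k + 4)}, x ≠ y → ¬ H.Adj x y → H.closedAdj x y = 0 := by
      intro x y hxy h
      simp [closedAdj, hxy, h]
    have hone : H.closedAdj p q + H.closedAdj q r + H.closedAdj p r ≤ 2 := by
      by_cases e1 : H.Adj p q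
      · by_cases e2 : H.Adj q r
        · linarith [hzero hpr fun e3 => hall ⟨e1, e2, e3⟩]
        · linarith [hzero hqr e2]
      · linarith [hzero hpq e1]
    linarith

end ThreeSets

/-! ### Triples separated by a restricted cut -/

section Fibers

variable {V : Type*} (G : SimpleGraph V)

/-- If every vertex outside a connected triple `X` is equal or adjacent, in its first coordinate,
to a vertex of `G` whose whole fibre avoids `X`, then `X` is separated by a `3`-restricted cut. -/
theorem isRestrictedEdgeCut_edgeBoundary {k : ℕ} {X : Set (V × Fin (k + 4))} (hX : X.encard = 3)
    (hconn : ((G.strongProd (cycleGraph (k + 4))).induce X).Connected) (hne : ∃ p, p ∉ X)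
    (hfib : ∀ p, p ∉ X → ∃ y, (p.1 = y ∨ G.Adj p.1 y) ∧ ∀ i, (y, i) ∉ X) :
    (G.strongProd (cycleGraph (k + 4))).IsRestrictedEdgeCut 3
      ((G.strongProd (cycleGraph (k + 4))).edgeBoundary X) := by
  set H := G.strongProd (cycleGraph (k + 4)) with hH
  obtain ⟨⟨a, ha⟩⟩ := hconn.nonempty
  obtain ⟨b, hb⟩ := hne
  refine ⟨H.isEdgeCut_edgeBoundary ha hb, fun c => ?_⟩
  induction c using ConnectedComponent.ind with | _ p
  by_cases hp : p ∈ X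
  · have hXc : X ⊆ ((H.deleteEdges (H.edgeBoundary X)).connectedComponentMk p).supp := by
      intro q hq
      rw [ConnectedComponent.mem_supp_iff, ConnectedComponent.eq]
      let φ : H.induce X →g H.deleteEdges (H.edgeBoundary X) :=
        ⟨Subtype.val, fun {u v} h => H.deleteEdges_edgeBoundary_adj h (by simp [u.2, v.2])⟩
      exact (hconn.preconnected ⟨q, hq⟩ ⟨p, hp⟩).map φ
    exact hX.symm.le.trans (Set.encard_le_encard hXc)
  · obtain ⟨y, hy, hyX⟩ := hfib p hp
    let φ : cycleGraph (k + 4) →g H.deleteEdges (H.edgeBoundary X) :=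
      ⟨fun i => (y, i), fun {i j} h =>
        H.deleteEdges_edgeBoundary_adj (Or.inl ⟨rfl, h⟩) (by simp [hyX])⟩
    have hpy : (H.deleteEdges (H.edgeBoundary X)).Reachable (y, p.2) p := by
      rcases hy with hy | hy
      · rw [← hy]
      · exact (H.deleteEdges_edgeBoundary_adj (u := (y, p.2)) (v := p)
          (Or.inr (Or.inl ⟨rfl, hy.symm⟩)) (by simp [hyX, hp])).reachable
    have hsub : Set.range φ ⊆
        ((H.deleteEdges (H.edgeBoundary X)).connectedComponentMk p).supp := by
      rintro _ ⟨i, rfl⟩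
      rw [ConnectedComponent.mem_supp_iff, ConnectedComponent.eq]
      exact ((cycleGraph_preconnected i p.2).map φ).trans hpy
    refine le_trans ?_ (Set.encard_le_encard hsub)
    have hinj : Function.Injective φ := fun i j h => congrArg Prod.snd h
    rw [← Set.image_univ, hinj.encard_image, Set.encard_univ]
    simp only [ENat.card_eq_coe_fintype_card, Fintype.card_fin]
    exact_mod_cast (by omega : 3 ≤ k + 4)

/-- Both invariants equal `t` as soon as `t` bounds all relevant cuts from below and is attained
by a connected triple that misses enough fibres. -/
theorem restrictedEdgeConnectivity_and_minThreeBoundary_eq [Fintype V] [DecidableEq V]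
    {k t : ℕ}
    (hlow : ∀ X : Finset (V × Fin (k + 4)), 3 ≤ #X → 3 ≤ #Xᶜ →
      (t : ℤ) ≤ (G.strongProd (cycleGraph (k + 4))).closedPairs X Xᶜ)
    (hV : 5 ≤ Fintype.card V) {X₀ : Finset (V × Fin (k + 4))} (hcard : #X₀ = 3)
    (hconn : ((G.strongProd (cycleGraph (k + 4))).induce (X₀ : Set _)).Connected)
    (hfib : ∀ p, p ∉ X₀ → ∃ y, (p.1 = y ∨ G.Adj p.1 y) ∧ ∀ i, (y, i) ∉ X₀)
    (hX₀ : (G.strongProd (cycleGraph (k + 4))).closedPairs X₀ X₀ᶜ ≤ t) :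
    (G.strongProd (cycleGraph (k + 4))).restrictedEdgeConnectivity 3 = (t : ℕ∞) ∧
      (G.strongProd (cycleGraph (k + 4))).minThreeBoundary = (t : ℕ∞) := by
  set H := G.strongProd (cycleGraph (k + 4)) with hH
  have hbd : ∀ X : Finset (V × Fin (k + 4)), 3 ≤ #X → 3 ≤ #Xᶜ →
      (t : ℕ∞) ≤ (H.edgeBoundary (X : Set _)).encard := by
    intro X h1 h2
    obtain ⟨N, hN, hN'⟩ := H.encard_edgeBoundary X
    have h := hlow X h1 h2
    rw [← hN'] at h
    rw [hN]
    exact_mod_cast h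
  have hbd₀ : (H.edgeBoundary (X₀ : Set _)).encard ≤ t := by
    obtain ⟨N, hN, hN'⟩ := H.encard_edgeBoundary X₀
    rw [← hN'] at hX₀
    rw [hN]
    exact_mod_cast hX₀
  have hcompl : ∀ X : Finset (V × Fin (k + 4)), #X = 3 → 3 ≤ #Xᶜ := by
    intro X hX
    have h := Finset.card_add_card_compl X
    rw [Fintype.card_prod, Fintype.card_fin] at h
    nlinarith
  have hencard : (X₀ : Set (V × Fin (k + 4))).encard = 3 := by
    rw [Set.encard_coe_eq_coe_finsetCard, hcard]
    rfl
  obtain ⟨q, hq⟩ : (X₀ᶜ).Nonempty :=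
    Finset.card_pos.1 (lt_of_lt_of_le (by norm_num) (hcompl X₀ hcard))
  refine ⟨le_antisymm ?_ ?_, le_antisymm ?_ ?_⟩
  · refine le_trans (iInf₂_le _ ?_) hbd₀
    exact G.isRestrictedEdgeCut_edgeBoundary hencard hconn
      ⟨q, by simpa using hq⟩ (by simpa using hfib)
  · refine le_iInf₂ fun S hS => ?_
    obtain ⟨X, h1, h2, hXS⟩ := hS.exists_edgeBoundary_subset
    exact (hbd X h1 h2).trans (Set.encard_le_encard hXS)
  · exact le_trans (iInf₂_le _ ⟨hencard, hconn⟩) hbd₀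
  · refine le_iInf₂ fun X hX => ?_
    classical
    have hXcard : #X.toFinset = 3 := by
      have h := hX.1
      rw [Set.encard_eq_coe_toFinset_card] at h
      exact_mod_cast h
    have h := hbd X.toFinset hXcard.ge (hcompl _ hXcard)
    rwa [Set.coe_toFinset] at h

end Fibers

/-! ### Vertices of minimum degree -/

section MinDegree

variable {V : Type*} (G : SimpleGraph V) [Fintype V] [DecidableRel G.Adj]

theorem exists_adj_ne_of_two_le_minDegree (hδ : 2 ≤ G.minDegree) (x z : V) :
    ∃ y, G.Adj x y ∧ y ≠ z := by
  have h : 1 < #(G.neighborFinset x) := by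
    rw [card_neighborFinset_eq_degree]
    exact lt_of_lt_of_le (by omega) (G.minDegree_le_degree x)
  obtain ⟨y, hy, hyz⟩ := Finset.exists_mem_ne h z
  exact ⟨y, (G.mem_neighborFinset x y).1 hy, hyz⟩

theorem minEdgeDegree_eq_iff (hδ : 2 ≤ G.minDegree) :
    G.minEdgeDegree = ((2 * G.minDegree - 2 : ℕ) : ℕ∞) ↔
      ∃ u v, G.Adj u v ∧ G.degree u = G.minDegree ∧ G.degree v = G.minDegree := by
  constructor
  · intro h
    by_contra! hno
    have hle : ((2 * G.minDegree - 1 : ℕ) : ℕ∞) ≤ G.minEdgeDegree := by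
      refine le_iInf₂ fun u v => le_iInf fun huv => ?_
      have h1 := G.minDegree_le_degree u
      have h2 := G.minDegree_le_degree v
      have h3 := hno u v huv
      have : 2 * G.minDegree - 1 ≤ G.degree u + G.degree v - 2 := by omega
      exact_mod_cast this
    rw [h] at hle
    have : 2 * G.minDegree - 1 ≤ 2 * G.minDegree - 2 := by exact_mod_cast hle
    omega
  · rintro ⟨u, v, huv, hu, hv⟩
    apply le_antisymm
    · refine (iInf₂_le u v).trans ((iInf_le _ huv).trans ?_)
      rw [hu, hv, two_mul]
    · refine le_iInf₂ fun u v => le_iInf fun huv => ?_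
      have h1 := G.minDegree_le_degree u
      have h2 := G.minDegree_le_degree v
      have : 2 * G.minDegree - 2 ≤ G.degree u + G.degree v - 2 := by omega
      exact_mod_cast this

end MinDegree

/-! ### Extremal triples and the final bounds -/

section Assembly

variable {V : Type*} (G : SimpleGraph V) [Fintype V] [DecidableEq V] [DecidableRel G.Adj]

/-- The bound for triples extends to all sets with at least three vertices inside and outside, as
larger sets satisfy the stronger bound `9d + 2`. -/
theorem le_cut_of_three_le {k : ℕ} {d t : ℤ} (hd : ∀ u, d ≤ G.degree u)
    (hcut : ∀ P : Finset V, P.Nonempty → P ≠ univ → d ≤ G.closedPairs P Pᶜ)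
    (hd2 : 2 ≤ d) (hV : 5 ≤ Fintype.card V) (ht : t ≤ 9 * d + 2)
    (hthree : ∀ X : Finset (V × Fin (k + 4)), #X = 3 →
      t ≤ (G.strongProd (cycleGraph (k + 4))).closedPairs X Xᶜ)
    (X : Finset (V × Fin (k + 4))) (hX : 3 ≤ #X) (hXc : 3 ≤ #Xᶜ) :
    t ≤ (G.strongProd (cycleGraph (k + 4))).closedPairs X Xᶜ := by
  rcases hX.eq_or_lt with h | h
  · exact hthree X h.symm
  rcases hXc.eq_or_lt with h' | h'
  · have := hthree Xᶜ h'.symm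
    rwa [compl_compl, closedPairs_comm] at this
  · exact ht.trans (G.nine_mul_add_two_le_cut hd hcut hd2 hV X h h')

theorem exists_triangle_triple {k d : ℕ} (hδ : 2 ≤ G.minDegree)
    {u v : V} (huv : G.Adj u v) (hu : G.degree u = d) (hv : G.degree v = d) :
    ∃ X : Finset (V × Fin (k + 4)), #X = 3 ∧
      ((G.strongProd (cycleGraph (k + 4))).induce (X : Set _)).Connected ∧
      (∀ p, p ∉ X → ∃ y, (p.1 = y ∨ G.Adj p.1 y) ∧ ∀ i, (y, i) ∉ X) ∧
      (G.strongProd (cycleGraph (k + 4))).closedPairs X Xᶜ ≤ ((9 * d : ℕ) : ℤ) := by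
  set H := G.strongProd (cycleGraph (k + 4)) with hH
  have hC : (cycleGraph (k + 4)).Adj 0 1 := by rw [cycleGraph_adj]; simp
  have h1 : H.Adj (u, 0) (u, 1) := Or.inl ⟨rfl, hC⟩
  have h2 : H.Adj (u, 0) (v, 0) := Or.inr (Or.inl ⟨rfl, huv⟩)
  have h3 : H.Adj (u, 1) (v, 0) := Or.inr (Or.inr ⟨huv, hC.symm⟩)
  refine ⟨{(u, 0), (u, 1), (v, 0)}, Finset.card_eq_three.2 ⟨_, _, _, h1.ne, h2.ne, h3.ne, rfl⟩,
    H.induce_connected_of_adj_adj (by simp) h1 h2, ?_, ?_⟩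
  · rintro ⟨a, i⟩ -
    have hout : ∀ y, y ≠ u → y ≠ v →
        ∀ i, (y, i) ∉ ({(u, 0), (u, 1), (v, 0)} : Finset (V × Fin (k + 4))) := by
      intro y h1 h2 i
      simp [h1, h2]
    by_cases hau : a = u
    · subst hau
      obtain ⟨y, hy, hyv⟩ := G.exists_adj_ne_of_two_le_minDegree hδ a v
      exact ⟨y, Or.inr hy, hout y hy.ne' hyv⟩
    by_cases hav : a = v
    · subst hav
      obtain ⟨y, hy, hyu⟩ := G.exists_adj_ne_of_two_le_minDegree hδ a u
      exact ⟨y, Or.inr hy, hout y hyu hy.ne'⟩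
    · exact ⟨a, Or.inl rfl, hout a hau hav⟩
  · rw [hH, G.cut_triple h1.ne h2.ne h3.ne, ← hH, h1.closedAdj_eq_one, h2.closedAdj_eq_one,
      h3.closedAdj_eq_one, hu, hv]
    push_cast
    linarith

theorem exists_path_triple {k d : ℕ} (hδ : 2 ≤ G.minDegree) {u : V} (hu : G.degree u = d) :
    ∃ X : Finset (V × Fin (k + 4)), #X = 3 ∧
      ((G.strongProd (cycleGraph (k + 4))).induce (X : Set _)).Connected ∧
      (∀ p, p ∉ X → ∃ y, (p.1 = y ∨ G.Adj p.1 y) ∧ ∀ i, (y, i) ∉ X) ∧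
      (G.strongProd (cycleGraph (k + 4))).closedPairs X Xᶜ ≤ ((9 * d + 2 : ℕ) : ℤ) := by
  set H := G.strongProd (cycleGraph (k + 4)) with hH
  have hC : (cycleGraph (k + 4)).Adj 0 1 := by rw [cycleGraph_adj]; simp
  have hC' : (cycleGraph (k + 4)).Adj 0 (-1) := by rw [cycleGraph_adj]; simp
  have hne : (1 : Fin (k + 4)) ≠ -1 := by simpa using fin_add_one_ne_sub_one (0 : Fin (k + 4))
  have h1 : H.Adj (u, 0) (u, 1) := Or.inl ⟨rfl, hC⟩
  have h2 : H.Adj (u, 0) (u, -1) := Or.inl ⟨rfl, hC'⟩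
  have h3 : ((u, 1) : V × Fin (k + 4)) ≠ (u, -1) := fun h => hne (congrArg Prod.snd h)
  refine ⟨{(u, 0), (u, 1), (u, -1)}, Finset.card_eq_three.2 ⟨_, _, _, h1.ne, h2.ne, h3, rfl⟩,
    H.induce_connected_of_adj_adj (by simp) h1 h2, ?_, ?_⟩
  · rintro ⟨a, i⟩ -
    have hout : ∀ y, y ≠ u →
        ∀ i, (y, i) ∉ ({(u, 0), (u, 1), (u, -1)} : Finset (V × Fin (k + 4))) := by
      intro y h1 i
      simp [h1]
    by_cases hau : a = u
    · subst hau
      obtain ⟨y, hy, -⟩ := G.exists_adj_ne_of_two_le_minDegree hδ a a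
      exact ⟨y, Or.inr hy, hout y hy.ne'⟩
    · exact ⟨a, Or.inl rfl, hout a hau⟩
  · rw [hH, G.cut_triple h1.ne h2.ne h3, ← hH, h1.closedAdj_eq_one, h2.closedAdj_eq_one, hu]
    have := H.closedAdj_nonneg (u, 1) (u, -1)
    push_cast
    linarith

end Assembly

end SimpleGraph

theorem theorem3p1 {V : Type*} [Fintype V] (G : SimpleGraph V) [DecidableRel G.Adj]
    (hG : G.IsMaximallyEdgeConnected) (hm : 5 ≤ Fintype.card V) (hδ : 2 ≤ G.minDegree)
    (n : ℕ) (hn : 4 ≤ n) :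
    (G.strongProd (SimpleGraph.cycleGraph n)).restrictedEdgeConnectivity 3 =
        (G.strongProd (SimpleGraph.cycleGraph n)).minThreeBoundary ∧
      (G.minEdgeDegree = ((2 * G.minDegree - 2 : ℕ) : ℕ∞) →
        (G.strongProd (SimpleGraph.cycleGraph n)).minThreeBoundary =
          ((9 * G.minDegree : ℕ) : ℕ∞)) ∧
      (G.minEdgeDegree ≠ ((2 * G.minDegree - 2 : ℕ) : ℕ∞) →
        (G.strongProd (SimpleGraph.cycleGraph n)).minThreeBoundary =
          ((9 * G.minDegree + 2 : ℕ) : ℕ∞)) ∧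
      (G.strongProd (SimpleGraph.cycleGraph n)).IsMaximallyThreeRestrictedEdgeConnected := by
  classical
  obtain ⟨k, rfl⟩ := Nat.exists_eq_add_of_le' hn
  have hd : ∀ u, (G.minDegree : ℤ) ≤ G.degree u := fun u => by
    exact_mod_cast G.minDegree_le_degree u
  have hcut : ∀ P : Finset V, P.Nonempty → P ≠ Finset.univ →
      (G.minDegree : ℤ) ≤ G.closedPairs P Pᶜ := fun P hP hP' =>
    hG.minDegree_le_closedPairs_compl hP hP'
  have hd2 : (2 : ℤ) ≤ G.minDegree := by exact_mod_cast hδ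
  by_cases hξ : G.minEdgeDegree = ((2 * G.minDegree - 2 : ℕ) : ℕ∞)
  · obtain ⟨u, v, huv, hu, hv⟩ := (G.minEdgeDegree_eq_iff hδ).1 hξ
    obtain ⟨X, h1, h2, h3, h4⟩ := G.exists_triangle_triple (k := k) hδ huv hu hv
    have h := G.restrictedEdgeConnectivity_and_minThreeBoundary_eq
      (G.le_cut_of_three_le hd hcut hd2 hm (by push_cast; linarith) fun X hX => by
        push_cast
        exact G.nine_mul_le_cut_of_card_eq_three hd hX) hm h1 h2 h3 h4
    have heq := h.1.trans h.2.symm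
    exact ⟨heq, fun _ => h.2, fun hne => absurd hξ hne, heq⟩
  · have hedge : ∀ u v, G.Adj u v → 2 * (G.minDegree : ℤ) + 1 ≤ G.degree u + G.degree v := by
      intro u v huv
      have h1 := G.minDegree_le_degree u
      have h2 := G.minDegree_le_degree v
      have h3 : ¬ (G.degree u = G.minDegree ∧ G.degree v = G.minDegree) := fun h =>
        hξ ((G.minEdgeDegree_eq_iff hδ).2 ⟨u, v, huv, h⟩)
      omega
    have : Nonempty V := Fintype.card_pos_iff.1 (by omega)
    obtain ⟨u, hu⟩ := G.exists_minimal_degree_vertex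
    obtain ⟨X, h1, h2, h3, h4⟩ := G.exists_path_triple (k := k) hδ hu.symm
    have h := G.restrictedEdgeConnectivity_and_minThreeBoundary_eq
      (G.le_cut_of_three_le hd hcut hd2 hm (by push_cast; linarith) fun X hX => by
        push_cast
        exact G.nine_mul_add_two_le_cut_of_card_eq_three hd hedge hX) hm h1 h2 h3 h4
    have heq := h.1.trans h.2.symm
    exact ⟨heq, fun hne => absurd hne hξ, fun _ => h.2, heq⟩
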